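/- Let $m\ge 0$, $a>1$ and $n\in\mathbb N$, $n\ge 1$. For $0\le j\le n$ put $\lambda_j=1-\frac{2j}{n}$, $$C_j(n,a)=\binom nj\Big(\frac{1+a}2\Big)^{n-j}\Big(\frac{1-a}2\Big)^j,\qquad F_n(x,a)=\sum_{j=0}^n C_j(n,a)e^{i\lambda_j x}.$$ Consider on $\mathbb R\times(0,\infty)$ the Cauchy problem for the Klein-Gordon equation with source $\delta(x)\delta(t)$, $$\Big(\frac{\partial^2}{\partial t^2}-\frac{\partial^2}{\partial x^2}+m^2\Big)u(x,t)=\delta(x)\delta(t),\qquad u(x,0)=F_n(x,a),\quad \partial_tu(x,0)=\partial_xF_n(x,a).$$ Since the source charges the initial line $t=0$, the problem is understood in the usual generalized sense: $u$, extended by zero to $t<0$, is a distribution $U\in\mathcal D'(\mathbb R^2)$ vanishing on $\{t<0\}$ with $$\Big(\frac{\partial^2}{\partial t^2}-\frac{\partial^2}{\partial x^2}+m^2\Big)U=\delta(x)\delta(t)+F_n(x,a)\,\delta'(t)+\partial_xF_n(x,a)\,\delta(t)\quad\text{in }\mathcal D'(\mathbb R^2).$$ Then the problem has exactly one solution, namely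 the (locally integrable) function $$v_n(x,t)=\sum_{j=0}^n C_j(n,a)e^{ix\lambda_j}\left[\cos\!\Big(\sqrt{m^2+\lambda_j^2}\,t\Big)+i\frac{\lambda_j}{\sqrt{m^2+\lambda_j^2}}\sin\!\Big(\sqrt{m^2+\lambda_j^2}\,t\Big)\right]+\frac12H(t-|x|)\,J_0\!\Big[m\sqrt{t^2-x^2}\Big],\quad t>0,$$ where $H$ is the Heaviside function, $J_0$ is the Bessel function of the first kind of order $0$, the last term is $0$ for $t<|x|$, and the sine term is read as $0$ when $m=\lambda_j=0$. Moreover, with the same formula used for all real $t$, the initial conditions hold pointwise off the support of the source: $v_n(x,0)=F_n(x,a)$ and $\partial_tv_n(x,0)=\partial_xF_n(x,a)$ for every $x\ne0$. -/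

import Mathlib

open MeasureTheory TopologicalSpace
open scoped Distributions LineDeriv Nat

noncomputable section

namespace KleinGordon

/-- The coefficient `C_j(n,a) = binom(n,j) ((1+a)/2)^(n-j) ((1-a)/2)^j` (used for `j ≤ n`). -/
def coeff (n j : ℕ) (a : ℝ) : ℝ :=
  (n.choose j : ℝ) * ((1 + a) / 2) ^ (n - j) * ((1 - a) / 2) ^ j

/-- The frequency `1 - 2j/n`. -/
def freq (n j : ℕ) : ℝ := 1 - 2 * (j : ℝ) / (n : ℝ)

/-- The superoscillating sequence `F_n(x,a) = ∑_{j=0}^n C_j(n,a) e^{i(1-2j/n)x}`. -/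
def superosc (n : ℕ) (a : ℝ) (x : ℝ) : ℂ :=
  ∑ j ∈ Finset.range (n + 1),
    (coeff n j a : ℂ) * Complex.exp (Complex.I * ((freq n j * x : ℝ) : ℂ))

/-- The Bessel function `J₀(z) = ∑_k (-1)^k / (k!)² (z/2)^{2k}` on the real line. -/
def besselJ0 (z : ℝ) : ℝ :=
  ∑' k : ℕ, (-1 : ℝ) ^ k / ((k ! : ℝ) ^ 2) * (z / 2) ^ (2 * k)

/-- The series defining `J₀` converges (absolutely) for every argument. -/
theorem summable_besselJ0 (z : ℝ) :
    Summable fun k : ℕ => (-1 : ℝ) ^ k / ((k ! : ℝ) ^ 2) * (z / 2) ^ (2 * k) := by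
  refine Summable.of_norm_bounded (Real.summable_pow_div_factorial ((z / 2) ^ 2)) fun k => ?_
  have h1 : (1 : ℝ) ≤ (k ! : ℝ) := by exact_mod_cast Nat.one_le_iff_ne_zero.2 k.factorial_ne_zero
  have h2 : (0 : ℝ) ≤ ((z / 2) ^ 2) ^ k := by positivity
  rw [norm_mul, norm_div, norm_pow, norm_neg, norm_one, one_pow, pow_mul,
    Real.norm_of_nonneg h2, Real.norm_of_nonneg (by positivity : (0 : ℝ) ≤ (k ! : ℝ) ^ 2),
    one_div_mul_eq_div]
  exact div_le_div_of_nonneg_left h2 (by positivity) (by nlinarith)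

/-- The Heaviside function. -/
def heaviside (s : ℝ) : ℝ := if 0 ≤ s then 1 else 0

/-- `w_m = √(m² + w²)`. -/
def dispersion (m w : ℝ) : ℝ := Real.sqrt (m ^ 2 + w ^ 2)

/-- The formula for `v_n(x,t)`. If `√(m² + λ²) = 0`, which happens only for `m = λ = 0`, the term
`λ / √(m² + λ²) · sin (√(m² + λ²) t)` is read as `0`; this is what Lean's division gives. -/
def solution (m : ℝ) (n : ℕ) (a : ℝ) (x t : ℝ) : ℂ :=
  (∑ j ∈ Finset.range (n + 1),
    (coeff n j a : ℂ) * Complex.exp (Complex.I * ((x * freq n j : ℝ) : ℂ)) *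
      ((Real.cos (dispersion m (freq n j) * t) : ℂ) +
        Complex.I * ((freq n j / dispersion m (freq n j) : ℝ) : ℂ) *
          (Real.sin (dispersion m (freq n j) * t) : ℂ))) +
    ((1 / 2 * heaviside (t - |x|) * besselJ0 (m * Real.sqrt (t ^ 2 - x ^ 2)) : ℝ) : ℂ)

/-- Complex distributions on the space-time plane; the point `(x, t)` has `x` as position and
`t` as time. -/
abbrev Dist : Type := 𝓓'((⊤ : Opens (ℝ × ℝ)), ℂ)

/-- The distribution `φ ↦ ∫ φ h dμ` given by a density `h` that is locally integrable for `μ`. -/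
def ofDensity (μ : Measure (ℝ × ℝ)) (h : ℝ × ℝ → ℂ) : Dist :=
  TestFunction.integralAgainstBilinCLM (ContinuousLinearMap.lsmul ℝ ℝ) μ h

theorem ofDensity_apply {μ : Measure (ℝ × ℝ)} {h : ℝ × ℝ → ℂ} (hh : LocallyIntegrable h μ)
    (ψ : 𝓓((⊤ : Opens (ℝ × ℝ)), ℝ)) : ofDensity μ h ψ = ∫ z, (ψ z : ℂ) * h z ∂μ := by
  have h' : LocallyIntegrableOn h ((⊤ : Opens (ℝ × ℝ)) : Set (ℝ × ℝ)) μ := hh.locallyIntegrableOn _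
  refine (TestFunction.integralAgainstBilinCLM_eq_integral h').trans ?_
  simp

/-- The distribution `u(x,t) 1_{t > 0}`: the extension by zero to `t ≤ 0` of a function `u` on
the upper half-plane. -/
def zeroExtension (u : ℝ → ℝ → ℂ) : Dist :=
  ofDensity ((volume : Measure (ℝ × ℝ)).restrict {z | 0 < z.2}) fun z => u z.1 z.2

/-- The distribution `f(x) δ(t)`, that is `φ ↦ ∫ f(x) φ(x,0) dx`. -/
def initialLayer (f : ℝ → ℂ) : Dist :=
  ofDensity ((volume : Measure ℝ).prod (Measure.dirac (0 : ℝ))) fun z => f z.1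

/-- The source `δ(x) δ(t)`, that is `φ ↦ φ(0,0)`. -/
def diracSource : Dist :=
  Distribution.mapCLM Complex.ofRealCLM (Distribution.delta ((0, 0) : ℝ × ℝ))

/-- The time derivative of a distribution. -/
def timeDeriv (U : Dist) : Dist := ∂_{((0, 1) : ℝ × ℝ)} U

/-- The space derivative of a distribution. -/
def spaceDeriv (U : Dist) : Dist := ∂_{((1, 0) : ℝ × ℝ)} U

/-- The Klein-Gordon operator `∂²/∂t² - ∂²/∂x² + m²` on distributions. -/
def kgOperator (m : ℝ) (U : Dist) : Dist :=
  timeDeriv (timeDeriv U) - spaceDeriv (spaceDeriv U) + (m ^ 2) • U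

/-- `U` solves the (generalized) Cauchy problem `(∂²/∂t² - ∂²/∂x² + m²) u = L` for `t > 0`,
`u(x,0) = f(x)`, `∂_t u(x,0) = g(x)`, where `L` is a distribution supported in `t ≥ 0`, possibly
charging the initial line `t = 0`. As is standard for such sources, `u` is extended by zero to
`t < 0`; the jumps `f` and `g` of `u` and `∂_t u` at `t = 0` then turn into the layers
`f(x) δ'(t)` and `g(x) δ(t)` on the right-hand side of the equation on the whole plane. -/
def SolvesCauchy (m : ℝ) (L : Dist) (f g : ℝ → ℂ) (U : Dist) : Prop :=
  Distribution.IsVanishingOn U {z : ℝ × ℝ | z.2 < 0} ∧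
    kgOperator m U = L + timeDeriv (initialLayer f) + initialLayer g

end KleinGordon

end

/-!
The problem splits into existence and uniqueness, and both rest on the identity
`∫ E · P f = f (0, 0)` for test functions `f`, where `P = ∂²/∂t² - ∂²/∂x² + m²` and
`E = ½ H(t - |x|) J₀(m √(t² - x²))` (`integral_fundSol_mul_kgFun`). In the characteristic
coordinates `p = t + x`, `q = t - x` one has `P = 4 ∂_p ∂_q + m²`, the forward light cone is the
quadrant `p, q > 0`, and `E = ½ G(p q)` with the entire function `G(s) = J₀(m √s)`. Bessel's equation
for `J₀` is `G' + s G'' = -(m² / 4) G`, that is `∂_p ∂_q G(p q) = -(m² / 4) G(p q)`; moreover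
`G(p q) = 1` on both axes. So two integrations by parts on the quadrant leave only the value of `f`
at its corner (`setIntegral_quadrant`).

*Existence.* The solution is the sum of `E` and a superposition `W` of plane waves. The function `W`
is a classical solution of `P W = 0` on the plane with `W = F_n` and `∂_t W = ∂_x F_n` for `t = 0`;
integrating by parts over `t > 0`, the boundary terms are the two layers in the equation
(`setIntegral_kgFun_smul_wave`). The term `E` contributes `δ(x) δ(t)`.

*Uniqueness.* Let `V` be a distribution that vanishes for `t < 0` with `P V = 0`. For a test
function `f`, the convolution `ψ` of `f` with the reflection of `E` is smooth, satisfies `P ψ = f`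
(`kgFun_backProp`) and is supported in a backward light cone (`backProp_eq_zero`). With a cutoff
`χ(t)` that is `0` for `t ≤ -1` and `1` for `t ≥ -1/2`, the function `χ ψ` is a test function and
`f - P (χ ψ)` is supported in `t < 0`. Hence `V f = V (P (χ ψ)) = (P V)(χ ψ) = 0`
(`eq_zero_of_kgOperator_eq_zero`).

Away from `x = 0` the term `E` vanishes for `t < |x|`, hence for all `t` near `0`, so that the
pointwise initial conditions are those of `W`.
-/

noncomputable section

namespace KleinGordon

/-! ### The power series of the Bessel function -/

/-- A power series whose coefficients are dominated by those of an exponential series can be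
differentiated term by term on the whole line. -/
theorem hasDerivAt_tsum_mul_pow {c : ℕ → ℝ} {A C : ℝ}
    (hc : ∀ k, |c k| ≤ A * (C ^ k / k !)) (s : ℝ) :
    HasDerivAt (fun s => ∑' k, c k * s ^ k) (∑' k : ℕ, ((k + 1 : ℕ) * c (k + 1)) * s ^ k) s := by
  set R := |s| + 1 with hR
  have hR0 : 0 ≤ R := by positivity
  -- `u k` bounds the derivative of the `k`-th term on the ball of radius `R`, which contains `s`.
  set u : ℕ → ℝ := fun k => |c k| * (k * R ^ (k - 1)) with hu
  have hus : Summable u := by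
    rw [← summable_nat_add_iff 1]
    refine Summable.of_nonneg_of_le (fun k => by positivity) (fun k => ?_)
      ((Real.summable_pow_div_factorial (C * R)).mul_left (A * C))
    calc u (k + 1) ≤ (A * (C ^ (k + 1) / (k + 1)!)) * ((k + 1 : ℕ) * R ^ k) := by
          exact mul_le_mul_of_nonneg_right (hc _) (by positivity)
      _ = A * C * ((C * R) ^ k / k !) := by
          rw [Nat.factorial_succ]
          push_cast
          rw [mul_pow]
          field_simp
          ring
  have h := hasDerivAt_tsum_of_isPreconnected (𝕜 := ℝ) (g := fun k s => c k * s ^ k)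
    (g' := fun k s => c k * (k * s ^ (k - 1))) hus (t := Metric.ball 0 R) Metric.isOpen_ball
    (convex_ball (0 : ℝ) R).isPreconnected (y₀ := 0) (y := s)
    (fun k y _ => (hasDerivAt_pow k y).const_mul (c k))
    (fun k y hy => by
      have hy' : |y| ≤ R := by simpa using (Metric.mem_ball.1 hy).le
      rw [norm_mul, norm_mul, norm_pow, Real.norm_eq_abs, Real.norm_eq_abs, Real.norm_eq_abs,
        Nat.abs_cast]
      simp only [hu]
      gcongr)
    (by simp [hR]; positivity)
    (summable_of_ne_finset_zero (s := {0}) fun k hk => by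
      simp at hk; simp [hk])
    (by simp [hR])
  have hsum : Summable fun k : ℕ => c k * (k * s ^ (k - 1)) := by
    refine hus.of_norm_bounded fun k => ?_
    rw [norm_mul, norm_mul, norm_pow, Real.norm_eq_abs, Real.norm_eq_abs, Real.norm_eq_abs,
        Nat.abs_cast]
    simp only [hu]
    gcongr
    simp [hR]
  rw [hsum.tsum_eq_zero_add] at h
  simp only [Nat.cast_zero, zero_mul, mul_zero, zero_add, Nat.add_sub_cancel] at h
  have hc : ∀ k : ℕ, ((k + 1 : ℕ) * c (k + 1)) * s ^ k = c (k + 1) * ((k + 1 : ℕ) * s ^ k) :=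
    fun k => by ring
  simpa only [hc] using h

/-- The coefficients of `s ↦ J₀(m √s)`. -/
def besselCoeff (m : ℝ) (k : ℕ) : ℝ := (-(m ^ 2 / 4)) ^ k / (k ! : ℝ) ^ 2

theorem abs_besselCoeff_le (m : ℝ) (k : ℕ) :
    |besselCoeff m k| ≤ 1 * ((m ^ 2 / 4) ^ k / k !) := by
  have h1 : (1 : ℝ) ≤ (k ! : ℝ) := by exact_mod_cast Nat.one_le_iff_ne_zero.2 k.factorial_ne_zero
  rw [besselCoeff, abs_div, abs_pow, abs_neg, abs_of_nonneg (by positivity : 0 ≤ m ^ 2 / 4),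
    abs_of_nonneg (by positivity : (0 : ℝ) ≤ (k ! : ℝ) ^ 2), one_mul]
  exact div_le_div_of_nonneg_left (by positivity) (by positivity) (by nlinarith)

theorem abs_succ_mul_besselCoeff_le (m : ℝ) (k : ℕ) :
    |(k + 1 : ℕ) * besselCoeff m (k + 1)| ≤ m ^ 2 / 4 * ((m ^ 2 / 4) ^ k / k !) := by
  rw [abs_mul, Nat.abs_cast]
  calc ((k + 1 : ℕ) : ℝ) * |besselCoeff m (k + 1)|
      ≤ (k + 1 : ℕ) * (1 * ((m ^ 2 / 4) ^ (k + 1) / (k + 1)!)) := by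
        gcongr; exact abs_besselCoeff_le m (k + 1)
    _ = _ := by
        rw [Nat.factorial_succ]
        push_cast
        rw [pow_succ]
        field_simp

/-- The entire function `s ↦ J₀(m √s)`. -/
def besselSeries (m s : ℝ) : ℝ := ∑' k, besselCoeff m k * s ^ k

/-- The derivative of `besselSeries m`, as a power series. -/
def besselSeriesDeriv (m s : ℝ) : ℝ :=
  ∑' k : ℕ, ((k + 1 : ℕ) * besselCoeff m (k + 1)) * s ^ k

/-- The second derivative of `besselSeries m`, as a power series. -/
def besselSeriesDeriv₂ (m s : ℝ) : ℝ :=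
  ∑' k : ℕ, ((k + 1 : ℕ) * ((k + 1 + 1 : ℕ) * besselCoeff m (k + 1 + 1))) * s ^ k

theorem hasDerivAt_besselSeries (m s : ℝ) :
    HasDerivAt (besselSeries m) (besselSeriesDeriv m s) s :=
  hasDerivAt_tsum_mul_pow (abs_besselCoeff_le m) s

theorem hasDerivAt_besselSeriesDeriv (m s : ℝ) :
    HasDerivAt (besselSeriesDeriv m) (besselSeriesDeriv₂ m s) s :=
  hasDerivAt_tsum_mul_pow (abs_succ_mul_besselCoeff_le m) s

theorem summable_mul_pow {c : ℕ → ℝ} {A C : ℝ}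
    (hc : ∀ k, |c k| ≤ A * (C ^ k / k !)) (s : ℝ) : Summable fun k => c k * s ^ k := by
  refine ((Real.summable_pow_div_factorial (C * |s|)).mul_left A).of_norm_bounded fun k => ?_
  rw [norm_mul, norm_pow, Real.norm_eq_abs, Real.norm_eq_abs, mul_pow]
  calc |c k| * |s| ^ k ≤ (A * (C ^ k / k !)) * |s| ^ k := by gcongr; exact hc k
    _ = _ := by ring

/-- The Bessel equation in the variable `s`: `G' + s G'' = -(m² / 4) G`. -/
theorem besselSeries_ode (m s : ℝ) :
    besselSeriesDeriv m s + s * besselSeriesDeriv₂ m s = -(m ^ 2 / 4) * besselSeries m s := by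
  set b : ℕ → ℝ := fun k => (k + 1 : ℕ) * besselCoeff m (k + 1) with hb
  have hG : Summable fun k => besselCoeff m k * s ^ k :=
    summable_mul_pow (abs_besselCoeff_le m) s
  have hb1 : Summable fun k => b k * s ^ k :=
    summable_mul_pow (abs_succ_mul_besselCoeff_le m) s
  -- The two-term recurrence `(k + 1)² c_{k+1} = -(m² / 4) c_k` of the coefficients.
  have hrec : ∀ k : ℕ, (k : ℝ) * b k * s ^ k
      = -(m ^ 2 / 4) * (besselCoeff m k * s ^ k) - b k * s ^ k := fun k => by
    have : ((k : ℝ) + 1) * b k = -(m ^ 2 / 4) * besselCoeff m k := by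
      simp only [hb, besselCoeff, Nat.factorial_succ]
      push_cast
      field_simp
      ring
    linear_combination s ^ k * this
  have hb2 : Summable fun k : ℕ => (k : ℝ) * b k * s ^ k := by
    simp only [hrec]
    exact (hG.mul_left _).sub hb1
  have h2 : s * besselSeriesDeriv₂ m s = ∑' k : ℕ, (k : ℝ) * b k * s ^ k := by
    rw [hb2.tsum_eq_zero_add, besselSeriesDeriv₂, ← tsum_mul_left]
    simp only [Nat.cast_zero, zero_mul, zero_add]
    exact tsum_congr fun k => by simp only [hb]; ring
  rw [h2, besselSeries, ← tsum_mul_left]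
  change (∑' k, b k * s ^ k) + _ = _
  rw [← hb1.tsum_add hb2]
  exact tsum_congr fun k => by rw [hrec]; ring

theorem besselSeries_zero (m : ℝ) : besselSeries m 0 = 1 := by
  rw [besselSeries, tsum_eq_single 0 fun k hk => by simp [hk]]
  simp [besselCoeff]

theorem continuous_besselSeries (m : ℝ) : Continuous (besselSeries m) :=
  continuous_iff_continuousAt.2 fun s => (hasDerivAt_besselSeries m s).continuousAt

theorem continuous_besselSeriesDeriv (m : ℝ) : Continuous (besselSeriesDeriv m) :=
  continuous_iff_continuousAt.2 fun s => (hasDerivAt_besselSeriesDeriv m s).continuousAt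

theorem besselJ0_mul_sqrt (m : ℝ) {s : ℝ} (hs : 0 ≤ s) :
    besselJ0 (m * Real.sqrt s) = besselSeries m s := by
  refine tsum_congr fun k => ?_
  rw [besselCoeff, pow_mul, div_pow, mul_pow, Real.sq_sqrt hs, neg_pow (m ^ 2 / 4),
    show m ^ 2 * s / 2 ^ 2 = m ^ 2 / 4 * s by ring, mul_pow]
  ring

/-! ### Directional derivatives of functions on the plane -/

/-- The derivative of a function on the plane in the direction `v`. -/
def dirDeriv (v : ℝ × ℝ) (f : ℝ × ℝ → ℝ) (z : ℝ × ℝ) : ℝ := fderiv ℝ f z v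

theorem contDiff_dirDeriv {f : ℝ × ℝ → ℝ} (hf : ContDiff ℝ (⊤ : ℕ∞) f) (v : ℝ × ℝ) :
    ContDiff ℝ (⊤ : ℕ∞) (dirDeriv v f) :=
  (hf.fderiv_right (m := (⊤ : ℕ∞)) (by simp)).clm_apply contDiff_const

theorem hasCompactSupport_dirDeriv {f : ℝ × ℝ → ℝ} (hf : HasCompactSupport f) (v : ℝ × ℝ) :
    HasCompactSupport (dirDeriv v f) :=
  (hf.fderiv ℝ).comp_left (g := fun A : ℝ × ℝ →L[ℝ] ℝ => A v) rfl

theorem hasDerivAt_fst {f : ℝ × ℝ → ℝ} (hf : ContDiff ℝ (⊤ : ℕ∞) f) (x t : ℝ) :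
    HasDerivAt (fun x => f (x, t)) (dirDeriv (1, 0) f (x, t)) x :=
  ((hf.differentiable (by simp)) (x, t)).hasFDerivAt.comp_hasDerivAt x
    ((hasDerivAt_id x).prodMk (hasDerivAt_const x t))

theorem hasDerivAt_snd {f : ℝ × ℝ → ℝ} (hf : ContDiff ℝ (⊤ : ℕ∞) f) (x t : ℝ) :
    HasDerivAt (fun t => f (x, t)) (dirDeriv (0, 1) f (x, t)) t :=
  ((hf.differentiable (by simp)) (x, t)).hasFDerivAt.comp_hasDerivAt t
    ((hasDerivAt_const t x).prodMk (hasDerivAt_id t))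

/-- The Klein-Gordon operator `∂²/∂t² - ∂²/∂x² + m²` on functions. -/
def kgFun (m : ℝ) (f : ℝ × ℝ → ℝ) (z : ℝ × ℝ) : ℝ :=
  dirDeriv (0, 1) (dirDeriv (0, 1) f) z - dirDeriv (1, 0) (dirDeriv (1, 0) f) z + m ^ 2 * f z

/-! ### Integration by parts -/

section IntegrationByParts

variable {V : Type*} [NormedAddCommGroup V] [NormedSpace ℝ V]

theorem hasCompactSupport_slice_fst {f : ℝ × ℝ → ℝ} (hf : HasCompactSupport f) (t : ℝ) :
    HasCompactSupport fun x => f (x, t) :=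
  HasCompactSupport.intro (hf.isCompact.image continuous_fst) fun x hx =>
    image_eq_zero_of_notMem_tsupport fun h => hx ⟨(x, t), h, rfl⟩

theorem hasCompactSupport_slice_snd {f : ℝ × ℝ → ℝ} (hf : HasCompactSupport f) (x : ℝ) :
    HasCompactSupport fun t => f (x, t) :=
  HasCompactSupport.intro (hf.isCompact.image continuous_snd) fun t ht =>
    image_eq_zero_of_notMem_tsupport fun h => ht ⟨(x, t), h, rfl⟩

section Line

variable {k k' : ℝ → ℝ} {g g' : ℝ → V}

/-- Integrability of the two terms of the derivative of `k • g`, for `k` of compact support. -/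
theorem integrable_smul_of_compact (hk : ∀ s, HasDerivAt k (k' s) s) (hk' : Continuous k')
    (hkc : HasCompactSupport k) (hg : ∀ s, HasDerivAt g (g' s) s) (hg' : Continuous g') :
    Integrable (fun s => k' s • g s) ∧ Integrable fun s => k s • g' s := by
  have hgc : Continuous g := continuous_iff_continuousAt.2 fun s => (hg s).continuousAt
  have hkcont : Continuous k := continuous_iff_continuousAt.2 fun s => (hk s).continuousAt
  have hk'c : HasCompactSupport k' := by
    have : k' = deriv k := funext fun s => (hk s).deriv.symm
    rw [this]
    exact hkc.deriv
  exact ⟨(hk'.smul hgc).integrable_of_hasCompactSupport hk'c.smul_right,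
    (hkcont.smul hg').integrable_of_hasCompactSupport hkc.smul_right⟩

theorem integral_Ioi_deriv_smul [CompleteSpace V] (hk : ∀ s, HasDerivAt k (k' s) s)
    (hk' : Continuous k') (hkc : HasCompactSupport k) (hg : ∀ s, HasDerivAt g (g' s) s)
    (hg' : Continuous g') (b : ℝ) :
    ∫ s in Set.Ioi b, k' s • g s = -(k b • g b) - ∫ s in Set.Ioi b, k s • g' s := by
  obtain ⟨h1, h2⟩ := integrable_smul_of_compact hk hk' hkc hg hg'
  have hgc : Continuous g := continuous_iff_continuousAt.2 fun s => (hg s).continuousAt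
  have hkcont : Continuous k := continuous_iff_continuousAt.2 fun s => (hk s).continuousAt
  have hd : ∀ s, HasDerivAt (fun s => k s • g s) (k s • g' s + k' s • g s) s :=
    fun s => (hk s).smul (hg s)
  have hd' : deriv (fun s => k s • g s) = fun s => k s • g' s + k' s • g s :=
    funext fun s => (hd s).deriv
  have hC : ContDiff ℝ 1 fun s => k s • g s := by
    rw [contDiff_one_iff_deriv, hd']
    exact ⟨fun s => (hd s).differentiableAt, (hkcont.smul hg').add (hk'.smul hgc)⟩
  have h := HasCompactSupport.integral_Ioi_deriv_eq hC hkc.smul_right b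
  rw [hd', integral_add h2.integrableOn h1.integrableOn] at h
  rw [← h]
  abel

theorem integral_deriv_smul [CompleteSpace V] (hk : ∀ s, HasDerivAt k (k' s) s)
    (hk' : Continuous k') (hkc : HasCompactSupport k) (hg : ∀ s, HasDerivAt g (g' s) s)
    (hg' : Continuous g') :
    ∫ s, k' s • g s = - ∫ s, k s • g' s := by
  obtain ⟨h1, h2⟩ := integrable_smul_of_compact hk hk' hkc hg hg'
  have hgc : Continuous g := continuous_iff_continuousAt.2 fun s => (hg s).continuousAt
  have hkcont : Continuous k := continuous_iff_continuousAt.2 fun s => (hk s).continuousAt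
  have h := integral_eq_zero_of_hasDerivAt_of_integrable (f := fun s => k s • g s)
    (fun s => (hk s).smul (hg s)) (h2.add h1)
    ((hkcont.smul hgc).integrable_of_hasCompactSupport hkc.smul_right)
  rw [integral_add h2 h1] at h
  exact eq_neg_of_add_eq_zero_right h

end Line

theorem integrable_smul_of_hasCompactSupport {f : ℝ × ℝ → ℝ} {g : ℝ × ℝ → V} (hf : Continuous f)
    (hfc : HasCompactSupport f) (hg : Continuous g) : Integrable fun z => f z • g z :=
  (hf.smul hg).integrable_of_hasCompactSupport hfc.smul_right

variable {f : ℝ × ℝ → ℝ} {g g' : ℝ × ℝ → V}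

theorem setIntegral_prod_smul {S T : Set ℝ} (hf : Continuous f) (hfc : HasCompactSupport f)
    (hg : Continuous g) :
    ∫ z in S ×ˢ T, f z • g z = ∫ x in S, ∫ t in T, f (x, t) • g (x, t) :=
  setIntegral_prod (μ := volume) (ν := volume) _
    (integrable_smul_of_hasCompactSupport hf hfc hg).integrableOn

theorem setIntegral_prod_smul_symm {S T : Set ℝ} (hf : Continuous f) (hfc : HasCompactSupport f)
    (hg : Continuous g) :
    ∫ z in S ×ˢ T, f z • g z = ∫ t in T, ∫ x in S, f (x, t) • g (x, t) := by
  have h := (integrable_smul_of_hasCompactSupport hf hfc hg).integrableOn (s := S ×ˢ T)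
  rw [IntegrableOn, Measure.volume_eq_prod, ← Measure.prod_restrict] at h
  rw [Measure.volume_eq_prod, ← Measure.prod_restrict]
  exact integral_prod_symm _ h

theorem integrable_slice_fst (hf : Continuous f) (hfc : HasCompactSupport f) (hg : Continuous g)
    (t : ℝ) : Integrable fun x => f (x, t) • g (x, t) :=
  ((hf.smul hg).comp (Continuous.prodMk_left t)).integrable_of_hasCompactSupport
    (hasCompactSupport_slice_fst hfc t).smul_right

theorem integrable_slice_snd (hf : Continuous f) (hfc : HasCompactSupport f) (hg : Continuous g)
    (x : ℝ) : Integrable fun t => f (x, t) • g (x, t) :=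
  ((hf.smul hg).comp (Continuous.prodMk_right x)).integrable_of_hasCompactSupport
    (hasCompactSupport_slice_snd hfc x).smul_right

variable [CompleteSpace V]

/-- Integration by parts in `t` on a region of the half-plane `t > 0`. -/
theorem setIntegral_dirDeriv_snd_smul (hf : ContDiff ℝ (⊤ : ℕ∞) f) (hfc : HasCompactSupport f)
    (hg : Continuous g) (hg' : Continuous g')
    (hgd : ∀ x t, HasDerivAt (fun t => g (x, t)) (g' (x, t)) t) (S : Set ℝ) :
    ∫ z in S ×ˢ Set.Ioi 0, dirDeriv (0, 1) f z • g z =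
      -(∫ x in S, f (x, 0) • g (x, 0)) - ∫ z in S ×ˢ Set.Ioi 0, f z • g' z := by
  have hfd := (contDiff_dirDeriv hf (0, 1)).continuous
  have hf0 := hf.continuous
  have hint := (integrable_smul_of_hasCompactSupport hf0 hfc hg').integrableOn
    (s := S ×ˢ Set.Ioi 0)
  rw [IntegrableOn, Measure.volume_eq_prod, ← Measure.prod_restrict] at hint
  rw [setIntegral_prod_smul hfd (hasCompactSupport_dirDeriv hfc _) hg,
    setIntegral_prod_smul hf0 hfc hg', ← integral_neg,
    ← integral_sub (f := fun x => -(f (x, 0) • g (x, 0)))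
      (integrable_slice_fst hf0 hfc hg 0).neg.integrableOn hint.integral_prod_left]
  congr 1 with x
  exact integral_Ioi_deriv_smul (fun t => hasDerivAt_snd hf x t)
    (hfd.comp (Continuous.prodMk_right x)) (hasCompactSupport_slice_snd hfc x) (hgd x)
    (hg'.comp (Continuous.prodMk_right x)) 0

/-- Integration by parts in the first variable on a region of the half-plane where it is
positive. -/
theorem setIntegral_dirDeriv_fst_smul (hf : ContDiff ℝ (⊤ : ℕ∞) f) (hfc : HasCompactSupport f)
    (hg : Continuous g) (hg' : Continuous g')
    (hgd : ∀ x t, HasDerivAt (fun x => g (x, t)) (g' (x, t)) x) (T : Set ℝ) :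
    ∫ z in Set.Ioi 0 ×ˢ T, dirDeriv (1, 0) f z • g z =
      -(∫ t in T, f (0, t) • g (0, t)) - ∫ z in Set.Ioi 0 ×ˢ T, f z • g' z := by
  have hfd := (contDiff_dirDeriv hf (1, 0)).continuous
  have hf0 := hf.continuous
  have hint := (integrable_smul_of_hasCompactSupport hf0 hfc hg').integrableOn
    (s := Set.Ioi 0 ×ˢ T)
  rw [IntegrableOn, Measure.volume_eq_prod, ← Measure.prod_restrict] at hint
  rw [setIntegral_prod_smul_symm hfd (hasCompactSupport_dirDeriv hfc _) hg,
    setIntegral_prod_smul_symm hf0 hfc hg', ← integral_neg,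
    ← integral_sub (f := fun t => -(f (0, t) • g (0, t)))
      (integrable_slice_snd hf0 hfc hg 0).neg.integrableOn hint.integral_prod_right]
  congr 1 with t
  exact integral_Ioi_deriv_smul (fun x => hasDerivAt_fst hf x t)
    (hfd.comp (Continuous.prodMk_left t)) (hasCompactSupport_slice_fst hfc t) (fun x => hgd x t)
    (hg'.comp (Continuous.prodMk_left t)) 0

/-- Integration by parts in the first variable over the whole line; there is no boundary term. -/
theorem setIntegral_dirDeriv_univ_smul (hf : ContDiff ℝ (⊤ : ℕ∞) f) (hfc : HasCompactSupport f)
    (hg : Continuous g) (hg' : Continuous g')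
    (hgd : ∀ x t, HasDerivAt (fun x => g (x, t)) (g' (x, t)) x) (T : Set ℝ) :
    ∫ z in Set.univ ×ˢ T, dirDeriv (1, 0) f z • g z = - ∫ z in Set.univ ×ˢ T, f z • g' z := by
  have hfd := (contDiff_dirDeriv hf (1, 0)).continuous
  have hf0 := hf.continuous
  rw [setIntegral_prod_smul_symm hfd (hasCompactSupport_dirDeriv hfc _) hg,
    setIntegral_prod_smul_symm hf0 hfc hg', ← integral_neg]
  congr 1 with t
  rw [Measure.restrict_univ]
  exact integral_deriv_smul (fun x => hasDerivAt_fst hf x t)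
    (hfd.comp (Continuous.prodMk_left t)) (hasCompactSupport_slice_fst hfc t) (fun x => hgd x t)
    (hg'.comp (Continuous.prodMk_left t))

end IntegrationByParts

/-! ### The fundamental solution -/

/-- The fundamental solution `½ H(t - |x|) J₀(m √(t² - x²))` of the Klein-Gordon operator. -/
def fundSol (m : ℝ) (z : ℝ × ℝ) : ℝ :=
  1 / 2 * heaviside (z.2 - |z.1|) * besselSeries m (z.2 ^ 2 - z.1 ^ 2)

theorem fundSol_eq (m x t : ℝ) :
    1 / 2 * heaviside (t - |x|) * besselJ0 (m * Real.sqrt (t ^ 2 - x ^ 2)) = fundSol m (x, t) := by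
  rw [fundSol, heaviside]
  split_ifs with h
  · rw [besselJ0_mul_sqrt]
    have h1 : |x| ≤ t := by linarith
    nlinarith [abs_nonneg x, sq_abs x]
  · simp

theorem fundSol_eq_indicator (m : ℝ) :
    fundSol m = Set.indicator {z : ℝ × ℝ | |z.1| ≤ z.2}
      fun z => 1 / 2 * besselSeries m (z.2 ^ 2 - z.1 ^ 2) := by
  funext z
  by_cases h : |z.1| ≤ z.2
  · simp [fundSol, heaviside, h]
  · simp [fundSol, heaviside, h]

theorem fundSol_eq_zero (m : ℝ) {z : ℝ × ℝ} (hz : z.2 < |z.1|) : fundSol m z = 0 := by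
  rw [fundSol_eq_indicator]
  exact Set.indicator_of_notMem (by simpa using hz) _

theorem continuous_besselSeries_interval (m : ℝ) :
    Continuous fun z : ℝ × ℝ => 1 / 2 * besselSeries m (z.2 ^ 2 - z.1 ^ 2) :=
  continuous_const.mul ((continuous_besselSeries m).comp (by fun_prop))

theorem locallyIntegrable_fundSol (m : ℝ) : LocallyIntegrable (fundSol m) := by
  rw [fundSol_eq_indicator]
  exact (continuous_besselSeries_interval m).locallyIntegrable.indicator
    (isClosed_le (by fun_prop) (by fun_prop)).measurableSet

/-- The characteristic coordinates: `(p, q) ↦ (x, t) = ((p - q) / 2, (p + q) / 2)`. -/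
def lightCone : (ℝ × ℝ) →L[ℝ] ℝ × ℝ :=
  ((1 / 2 : ℝ) • (ContinuousLinearMap.fst ℝ ℝ ℝ - ContinuousLinearMap.snd ℝ ℝ ℝ)).prod
    ((1 / 2 : ℝ) • (ContinuousLinearMap.fst ℝ ℝ ℝ + ContinuousLinearMap.snd ℝ ℝ ℝ))

theorem lightCone_apply (z : ℝ × ℝ) :
    lightCone z = (1 / 2 * (z.1 - z.2), 1 / 2 * (z.1 + z.2)) := rfl

theorem det_lightCone : LinearMap.det (lightCone : (ℝ × ℝ) →ₗ[ℝ] ℝ × ℝ) = 1 / 2 := by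
  rw [← LinearMap.det_toMatrix (Module.Basis.finTwoProd ℝ), Matrix.det_fin_two]
  simp [LinearMap.toMatrix_apply, lightCone_apply]
  norm_num

theorem det_lightCone_ne_zero : LinearMap.det (lightCone : (ℝ × ℝ) →ₗ[ℝ] ℝ × ℝ) ≠ 0 := by
  rw [det_lightCone]; norm_num

/-- The characteristic coordinates as a homeomorphism. -/
def lightConeHomeomorph : (ℝ × ℝ) ≃ₜ ℝ × ℝ :=
  (LinearMap.equivOfDetNeZero _ det_lightCone_ne_zero).toContinuousLinearEquiv.toHomeomorph

/-- Integrals over the plane in characteristic coordinates. -/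
theorem integral_comp_lightCone (h : ℝ × ℝ → ℝ) :
    ∫ z, h z = 1 / 2 * ∫ z, h (lightCone z) := by
  have hmap := Measure.map_linearMap_addHaar_eq_smul_addHaar (volume : Measure (ℝ × ℝ))
    det_lightCone_ne_zero
  have he : MeasurableEmbedding (lightCone : ℝ × ℝ → ℝ × ℝ) :=
    lightConeHomeomorph.measurableEmbedding
  have h1 := he.integral_map (μ := volume) h
  have h2 : Measure.map (lightCone : ℝ × ℝ → ℝ × ℝ) volume
      = ENNReal.ofReal |(LinearMap.det (lightCone : (ℝ × ℝ) →ₗ[ℝ] ℝ × ℝ))⁻¹| • volume := hmap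
  rw [← h1, h2, integral_smul_measure, det_lightCone, ENNReal.toReal_ofReal (abs_nonneg _),
    smul_eq_mul, ← mul_assoc]
  norm_num

/-- In characteristic coordinates the fundamental solution is `½ G(p q)` on the quadrant
`p, q > 0`, up to the null set formed by the two axes. -/
theorem integral_fundSol_mul (m : ℝ) (h : ℝ × ℝ → ℝ) :
    ∫ z, fundSol m z * h z =
      1 / 4 * ∫ z in Set.Ioi 0 ×ˢ Set.Ioi 0, besselSeries m (z.1 * z.2) * h (lightCone z) := by
  rw [integral_comp_lightCone]
  have h1 : ∀ z : ℝ × ℝ, fundSol m (lightCone z) * h (lightCone z) =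
      Set.indicator (Set.Ici 0 ×ˢ Set.Ici 0)
        (fun z => 1 / 2 * (besselSeries m (z.1 * z.2) * h (lightCone z))) z := fun z => by
    have hiff : |(lightCone z).1| ≤ (lightCone z).2 ↔ z ∈ Set.Ici (0 : ℝ) ×ˢ Set.Ici (0 : ℝ) := by
      rw [lightCone_apply, abs_le, Set.mem_prod, Set.mem_Ici, Set.mem_Ici]
      constructor <;> rintro ⟨h1, h2⟩ <;> constructor <;> linarith
    rw [fundSol_eq_indicator]
    by_cases hz : z ∈ Set.Ici (0 : ℝ) ×ˢ Set.Ici (0 : ℝ)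
    · rw [Set.indicator_of_mem hz, Set.indicator_of_mem (by exact hiff.2 hz), lightCone_apply]
      ring_nf
    · rw [Set.indicator_of_notMem hz, Set.indicator_of_notMem (by exact fun h => hz (hiff.1 h)),
        zero_mul]
  simp_rw [h1]
  rw [integral_indicator (measurableSet_Ici.prod measurableSet_Ici), integral_const_mul]
  have h2 : (Set.Ici (0 : ℝ) ×ˢ Set.Ici (0 : ℝ) : Set (ℝ × ℝ)) =ᵐ[volume]
      Set.Ioi (0 : ℝ) ×ˢ Set.Ioi (0 : ℝ) := by
    rw [Measure.volume_eq_prod]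
    exact Measure.set_prod_ae_eq Ioi_ae_eq_Ici.symm Ioi_ae_eq_Ici.symm
  rw [setIntegral_congr_set h2]
  ring

/-- Green's identity on the quadrant `p, q > 0` for the Riemann function `G(p q)`, which solves
`∂_p ∂_q g = -(m² / 4) g` and equals `1` on both axes. -/
theorem setIntegral_quadrant (m : ℝ) {f : ℝ × ℝ → ℝ} (hf : ContDiff ℝ (⊤ : ℕ∞) f)
    (hfc : HasCompactSupport f) :
    ∫ z in Set.Ioi 0 ×ˢ Set.Ioi 0, besselSeries m (z.1 * z.2) *
      (dirDeriv (1, 0) (dirDeriv (0, 1) f) z + m ^ 2 / 4 * f z) = f (0, 0) := by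
  have hmul : Continuous fun z : ℝ × ℝ => z.1 * z.2 := by fun_prop
  have hg : Continuous fun z : ℝ × ℝ => besselSeries m (z.1 * z.2) :=
    (continuous_besselSeries m).comp hmul
  have hg1 : Continuous fun z : ℝ × ℝ => z.2 * besselSeriesDeriv m (z.1 * z.2) :=
    continuous_snd.mul ((continuous_besselSeriesDeriv m).comp hmul)
  have hg2 : Continuous fun z : ℝ × ℝ => -(m ^ 2 / 4) * besselSeries m (z.1 * z.2) :=
    continuous_const.mul hg
  have hd1 : ∀ p q : ℝ, HasDerivAt (fun p => besselSeries m (p * q))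
      (q * besselSeriesDeriv m (p * q)) p := fun p q => by
    have := (hasDerivAt_besselSeries m (p * q)).comp p ((hasDerivAt_id p).mul_const q)
    rw [one_mul, mul_comm] at this
    exact this
  have hd2 : ∀ p q : ℝ, HasDerivAt (fun q => q * besselSeriesDeriv m (p * q))
      (-(m ^ 2 / 4) * besselSeries m (p * q)) q := fun p q => by
    have h := (hasDerivAt_id q).mul
      ((hasDerivAt_besselSeriesDeriv m (p * q)).comp q ((hasDerivAt_id q).const_mul p))
    refine h.congr_deriv ?_
    rw [← besselSeries_ode]
    simp
    ring
  have hfq := contDiff_dirDeriv hf (0, 1)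
  have hfqc := hasCompactSupport_dirDeriv hfc (0, 1)
  have hfpq := contDiff_dirDeriv hfq (1, 0)
  have hfpqc := hasCompactSupport_dirDeriv hfqc (1, 0)
  have e1 := setIntegral_dirDeriv_fst_smul hfq hfqc hg hg1 hd1 (Set.Ioi 0)
  have e2 := setIntegral_dirDeriv_snd_smul hf hfc hg1 hg2 hd2 (Set.Ioi 0)
  have e3 : ∫ q in Set.Ioi 0, dirDeriv (0, 1) f (0, q) = - f (0, 0) := by
    have := integral_Ioi_deriv_smul (fun t => hasDerivAt_snd hf 0 t)
      (hfq.continuous.comp (Continuous.prodMk_right 0)) (hasCompactSupport_slice_snd hfc 0)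
      (fun s => hasDerivAt_const s (1 : ℝ)) continuous_const 0
    simpa using this
  simp only [smul_eq_mul, zero_mul, besselSeries_zero, mul_one, e3] at e1
  -- The factor `q` in `∂_p G(p q) = q G'(p q)` kills the boundary term on the axis `q = 0`.
  simp only [smul_eq_mul, zero_mul, mul_zero, integral_zero, neg_zero, zero_sub] at e2
  rw [e2] at e1
  have i1 : IntegrableOn (fun z : ℝ × ℝ => dirDeriv (1, 0) (dirDeriv (0, 1) f) z *
      besselSeries m (z.1 * z.2)) (Set.Ioi 0 ×ˢ Set.Ioi 0) :=
    (integrable_smul_of_hasCompactSupport hfpq.continuous hfpqc hg).integrableOn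
  have i2 : IntegrableOn (fun z : ℝ × ℝ => f z * (-(m ^ 2 / 4) * besselSeries m (z.1 * z.2)))
      (Set.Ioi 0 ×ˢ Set.Ioi 0) :=
    (integrable_smul_of_hasCompactSupport hf.continuous hfc hg2).integrableOn
  have h3 : ∀ z : ℝ × ℝ, besselSeries m (z.1 * z.2) *
      (dirDeriv (1, 0) (dirDeriv (0, 1) f) z + m ^ 2 / 4 * f z) =
      dirDeriv (1, 0) (dirDeriv (0, 1) f) z * besselSeries m (z.1 * z.2) -
        f z * (-(m ^ 2 / 4) * besselSeries m (z.1 * z.2)) := fun z => by ring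
  simp_rw [h3]
  rw [integral_sub i1 i2, e1]
  ring

theorem dirDeriv_comp_lightCone {f : ℝ × ℝ → ℝ} (hf : ContDiff ℝ (⊤ : ℕ∞) f) (v : ℝ × ℝ) :
    dirDeriv v (f ∘ lightCone) = dirDeriv (lightCone v) f ∘ lightCone := by
  funext z
  simp only [dirDeriv, Function.comp_apply]
  rw [fderiv_comp z (hf.differentiable (by simp) _) lightCone.differentiableAt,
    ContinuousLinearMap.fderiv]
  rfl

theorem dirDeriv_dirDeriv {f : ℝ × ℝ → ℝ} (hf : ContDiff ℝ (⊤ : ℕ∞) f) (v w z : ℝ × ℝ) :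
    dirDeriv v (dirDeriv w f) z = fderiv ℝ (fderiv ℝ f) z v w := by
  have hd : DifferentiableAt ℝ (fderiv ℝ f) z :=
    (hf.fderiv_right (m := (⊤ : ℕ∞)) (by simp)).differentiable (by simp) z
  change fderiv ℝ (fun z => fderiv ℝ f z w) z v = _
  rw [fderiv_clm_apply hd (differentiableAt_const w)]
  simp

/-- The wave operator is `4 ∂_p ∂_q` in characteristic coordinates. -/
theorem kgFun_lightCone (m : ℝ) {f : ℝ × ℝ → ℝ} (hf : ContDiff ℝ (⊤ : ℕ∞) f) (z : ℝ × ℝ) :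
    kgFun m f (lightCone z) = 4 * (dirDeriv (1, 0) (dirDeriv (0, 1) (f ∘ lightCone)) z +
      m ^ 2 / 4 * (f ∘ lightCone) z) := by
  rw [dirDeriv_comp_lightCone hf, dirDeriv_comp_lightCone (contDiff_dirDeriv hf _), kgFun]
  simp only [Function.comp_apply, dirDeriv_dirDeriv hf]
  have hs := (hf.contDiffAt (x := lightCone z)).isSymmSndFDerivAt
    (minSmoothness_of_isRCLikeNormedField (𝕜 := ℝ) ▸ WithTop.coe_le_coe.2 (le_top : (2 : ℕ∞) ≤ ⊤))
  have e1 : lightCone (1, 0) = (1 / 2 : ℝ) • ((1, 0) + (0, 1)) := by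
    simp [lightCone_apply]
  have e2 : lightCone (0, 1) = (1 / 2 : ℝ) • ((0, 1) - (1, 0)) := by
    simp [lightCone_apply]
  rw [e1, e2]
  simp only [map_smul, map_add, map_sub, add_apply, smul_apply, smul_eq_mul]
  -- The mixed second derivatives cancel by symmetry.
  rw [hs (0, 1) (1, 0)]
  ring

/-- `fundSol m` is a fundamental solution of the Klein-Gordon operator. -/
theorem integral_fundSol_mul_kgFun (m : ℝ) {f : ℝ × ℝ → ℝ} (hf : ContDiff ℝ (⊤ : ℕ∞) f)
    (hfc : HasCompactSupport f) : ∫ z, fundSol m z * kgFun m f z = f (0, 0) := by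
  have hc : HasCompactSupport (f ∘ lightCone) := hfc.comp_homeomorph lightConeHomeomorph
  rw [integral_fundSol_mul]
  simp_rw [kgFun_lightCone m hf, mul_left_comm (besselSeries m _) 4]
  rw [integral_const_mul, setIntegral_quadrant m (hf.comp lightCone.contDiff) hc]
  simp [lightCone_apply]

/-! ### The superposition of plane waves -/

/-- The time factor `cos (w_m t) + i (w / w_m) sin (w_m t)` of the plane wave of frequency `w`. -/
def timeFactor (m w t : ℝ) : ℂ :=
  (Real.cos (dispersion m w * t) : ℂ) +
    Complex.I * ((w / dispersion m w : ℝ) : ℂ) * (Real.sin (dispersion m w * t) : ℂ)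

/-- The time derivative of `timeFactor m w`. -/
def timeFactorDeriv (m w t : ℝ) : ℂ :=
  -(dispersion m w * Real.sin (dispersion m w * t) : ℝ) +
    Complex.I * ((w / dispersion m w : ℝ) : ℂ) *
      (dispersion m w * Real.cos (dispersion m w * t) : ℝ)

theorem hasDerivAt_timeFactor (m w t : ℝ) :
    HasDerivAt (timeFactor m w) (timeFactorDeriv m w t) t := by
  have h : HasDerivAt (fun t : ℝ => dispersion m w * t) (dispersion m w) t := by
    simpa using (hasDerivAt_id t).const_mul (dispersion m w)
  have hc := h.cos.ofReal_comp
  have hs := h.sin.ofReal_comp.const_mul (Complex.I * ((w / dispersion m w : ℝ) : ℂ))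
  refine (hc.add hs).congr_deriv ?_
  rw [timeFactorDeriv]
  push_cast
  ring

theorem hasDerivAt_timeFactorDeriv (m w t : ℝ) :
    HasDerivAt (timeFactorDeriv m w) (-(m ^ 2 + w ^ 2 : ℝ) * timeFactor m w t) t := by
  have h : HasDerivAt (fun t : ℝ => dispersion m w * t) (dispersion m w) t := by
    simpa using (hasDerivAt_id t).const_mul (dispersion m w)
  have hc := (h.sin.const_mul (dispersion m w)).ofReal_comp.neg
  have hs := (h.cos.const_mul (dispersion m w)).ofReal_comp.const_mul
    (Complex.I * ((w / dispersion m w : ℝ) : ℂ))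
  refine (hc.add hs).congr_deriv ?_
  have hd : m ^ 2 + w ^ 2 = dispersion m w * dispersion m w :=
    (Real.mul_self_sqrt (by positivity)).symm
  rw [timeFactor, hd]
  push_cast
  ring

theorem timeFactor_zero (m w : ℝ) : timeFactor m w 0 = 1 := by
  simp [timeFactor]

theorem timeFactorDeriv_zero (m w : ℝ) : timeFactorDeriv m w 0 = Complex.I * w := by
  -- If `w_m = 0` then `w = 0`, so that the quotient `w / 0` is harmless.
  by_cases h : dispersion m w = 0
  · have hw : w = 0 := by
      have := (Real.sqrt_eq_zero (by positivity)).1 h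
      nlinarith [sq_nonneg m, sq_nonneg w]
    simp [timeFactorDeriv, hw]
  · simp only [timeFactorDeriv, mul_zero, Real.sin_zero, Real.cos_zero, mul_one]
    have : (dispersion m w : ℂ) ≠ 0 := by exact_mod_cast h
    push_cast
    field_simp
    ring

theorem continuous_timeFactor (m w : ℝ) : Continuous (timeFactor m w) :=
  continuous_iff_continuousAt.2 fun t => (hasDerivAt_timeFactor m w t).continuousAt

theorem continuous_timeFactorDeriv (m w : ℝ) : Continuous (timeFactorDeriv m w) :=
  continuous_iff_continuousAt.2 fun t => (hasDerivAt_timeFactorDeriv m w t).continuousAt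

/-- The space factor `e^{iwx}` of the plane wave of frequency `w`. -/
def spaceFactor (w x : ℝ) : ℂ := Complex.exp (Complex.I * ((x * w : ℝ) : ℂ))

theorem hasDerivAt_spaceFactor (w x : ℝ) :
    HasDerivAt (spaceFactor w) (Complex.I * w * spaceFactor w x) x := by
  have h : HasDerivAt (fun x : ℝ => Complex.I * ((x * w : ℝ) : ℂ)) (Complex.I * w) x := by
    simpa using ((hasDerivAt_id x).mul_const w).ofReal_comp.const_mul Complex.I
  refine h.cexp.congr_deriv ?_
  rw [spaceFactor]
  ring

theorem continuous_spaceFactor (w : ℝ) : Continuous (spaceFactor w) :=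
  continuous_iff_continuousAt.2 fun x => (hasDerivAt_spaceFactor w x).continuousAt

/-- The superposition `∑_j C_j κ_j e^{i λ_j x} T_j(t)` with arbitrary constants `κ_j` and time
factors `T_j`: a family closed under both partial derivatives. -/
def waveSum (n : ℕ) (a : ℝ) (κ : ℕ → ℂ) (T : ℕ → ℝ → ℂ) (z : ℝ × ℝ) : ℂ :=
  ∑ j ∈ Finset.range (n + 1),
    (coeff n j a : ℂ) * (κ j * spaceFactor (freq n j) z.1) * T j z.2

theorem continuous_waveSum {n : ℕ} {a : ℝ} {κ : ℕ → ℂ} {T : ℕ → ℝ → ℂ}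
    (hT : ∀ j, Continuous (T j)) : Continuous (waveSum n a κ T) :=
  continuous_finsetSum _ fun j _ =>
    (continuous_const.mul
      (continuous_const.mul ((continuous_spaceFactor _).comp continuous_fst))).mul
      ((hT j).comp continuous_snd)

theorem hasDerivAt_waveSum_snd {n : ℕ} {a : ℝ} {κ : ℕ → ℂ} {T T' : ℕ → ℝ → ℂ}
    (hT : ∀ j t, HasDerivAt (T j) (T' j t) t) (x t : ℝ) :
    HasDerivAt (fun t => waveSum n a κ T (x, t)) (waveSum n a κ T' (x, t)) t :=
  HasDerivAt.fun_sum fun j _ =>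
    (hT j t).const_mul ((coeff n j a : ℂ) * (κ j * spaceFactor (freq n j) x))

theorem hasDerivAt_waveSum_fst {n : ℕ} {a : ℝ} {κ : ℕ → ℂ} {T : ℕ → ℝ → ℂ} (x t : ℝ) :
    HasDerivAt (fun x => waveSum n a κ T (x, t))
      (waveSum n a (fun j => κ j * (Complex.I * freq n j)) T (x, t)) x :=
  HasDerivAt.fun_sum fun j _ => by
    refine ((((hasDerivAt_spaceFactor (freq n j) x).const_mul (κ j)).const_mul
      (coeff n j a : ℂ)).mul_const (T j t)).congr_deriv ?_
    ring

/-- The plane-wave part of the solution. -/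
def wave (m : ℝ) (n : ℕ) (a : ℝ) : ℝ × ℝ → ℂ :=
  waveSum n a (fun _ => 1) fun j => timeFactor m (freq n j)

/-- The time derivative of the plane-wave part of the solution. -/
def waveDeriv (m : ℝ) (n : ℕ) (a : ℝ) : ℝ × ℝ → ℂ :=
  waveSum n a (fun _ => 1) fun j => timeFactorDeriv m (freq n j)

theorem continuous_wave (m : ℝ) (n : ℕ) (a : ℝ) : Continuous (wave m n a) :=
  continuous_waveSum fun _ => continuous_timeFactor _ _

theorem hasDerivAt_wave (m : ℝ) (n : ℕ) (a : ℝ) (x t : ℝ) :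
    HasDerivAt (fun t => wave m n a (x, t)) (waveDeriv m n a (x, t)) t :=
  hasDerivAt_waveSum_snd (fun _ => hasDerivAt_timeFactor _ _) x t

theorem solution_eq (m : ℝ) (n : ℕ) (a x t : ℝ) :
    solution m n a x t = wave m n a (x, t) + (fundSol m (x, t) : ℂ) := by
  rw [solution, fundSol_eq]
  congr 1
  exact Finset.sum_congr rfl fun j _ => by simp only [one_mul, spaceFactor, timeFactor]

theorem wave_zero (m : ℝ) (n : ℕ) (a x : ℝ) : wave m n a (x, 0) = superosc n a x := by
  simp only [wave, waveSum, superosc]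
  refine Finset.sum_congr rfl fun j _ => ?_
  simp only [one_mul, spaceFactor, timeFactor_zero, mul_one, mul_comm x]

theorem hasDerivAt_superosc (m : ℝ) (n : ℕ) (a x : ℝ) :
    HasDerivAt (superosc n a) (waveDeriv m n a (x, 0)) x := by
  have h := hasDerivAt_waveSum_fst (n := n) (a := a) (κ := fun _ => 1)
    (T := fun j => timeFactor m (freq n j)) x 0
  have h0 : (fun x => waveSum n a (fun _ => 1) (fun j => timeFactor m (freq n j)) (x, 0))
      = superosc n a := funext fun x => wave_zero m n a x
  rw [h0] at h
  refine h.congr_deriv (Finset.sum_congr rfl fun j _ => ?_)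
  simp only [timeFactor_zero, timeFactorDeriv_zero]
  ring

theorem continuous_waveDeriv (m : ℝ) (n : ℕ) (a : ℝ) : Continuous (waveDeriv m n a) :=
  continuous_waveSum fun _ => continuous_timeFactorDeriv _ _

theorem deriv_superosc (m : ℝ) (n : ℕ) (a x : ℝ) :
    deriv (superosc n a) x = waveDeriv m n a (x, 0) :=
  (hasDerivAt_superosc m n a x).deriv

/-- Green's identity on the half-plane `t > 0` for the plane-wave part of the solution. -/
theorem setIntegral_kgFun_smul_wave (m : ℝ) (n : ℕ) (a : ℝ) {f : ℝ × ℝ → ℝ}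
    (hf : ContDiff ℝ (⊤ : ℕ∞) f) (hfc : HasCompactSupport f) :
    ∫ z in Set.univ ×ˢ Set.Ioi 0, kgFun m f z • wave m n a z =
      -(∫ x, dirDeriv (0, 1) f (x, 0) • wave m n a (x, 0)) +
        ∫ x, f (x, 0) • waveDeriv m n a (x, 0) := by
  set D : Set (ℝ × ℝ) := Set.univ ×ˢ Set.Ioi 0
  set Wtt := waveSum n a (fun _ => 1)
    fun j t => -(m ^ 2 + freq n j ^ 2 : ℝ) * timeFactor m (freq n j) t with hWtt
  set Wx := waveSum n a (fun j => 1 * (Complex.I * freq n j)) fun j => timeFactor m (freq n j)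
    with hWx
  set Wxx := waveSum n a (fun j => 1 * (Complex.I * freq n j) * (Complex.I * freq n j))
    fun j => timeFactor m (freq n j) with hWxx
  have cWtt : Continuous Wtt :=
    continuous_waveSum fun _ => continuous_const.mul (continuous_timeFactor _ _)
  have cWx : Continuous Wx := continuous_waveSum fun _ => continuous_timeFactor _ _
  have cWxx : Continuous Wxx := continuous_waveSum fun _ => continuous_timeFactor _ _
  have cW := continuous_wave m n a
  have cWt := continuous_waveDeriv m n a
  have hpde : ∀ z, Wtt z = Wxx z - (m ^ 2 : ℝ) • wave m n a z := fun z => by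
    simp only [hWtt, hWxx, wave, waveSum, Finset.smul_sum, ← Finset.sum_sub_distrib]
    refine Finset.sum_congr rfl fun j _ => ?_
    rw [Complex.real_smul]
    push_cast
    linear_combination (-(coeff n j a : ℂ) * spaceFactor (freq n j) z.1 *
      timeFactor m (freq n j) z.2 * (freq n j : ℂ) ^ 2) * Complex.I_sq
  have hft := contDiff_dirDeriv hf (0, 1)
  have hfx := contDiff_dirDeriv hf (1, 0)
  have hftc := hasCompactSupport_dirDeriv hfc (0, 1)
  have hfxc := hasCompactSupport_dirDeriv hfc (1, 0)
  have hftt := contDiff_dirDeriv hft (0, 1)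
  have hfxx := contDiff_dirDeriv hfx (1, 0)
  have hfttc := hasCompactSupport_dirDeriv hftc (0, 1)
  have hfxxc := hasCompactSupport_dirDeriv hfxc (1, 0)
  have t1 := setIntegral_dirDeriv_snd_smul hft hftc cW cWt (hasDerivAt_wave m n a) Set.univ
  have t2 := setIntegral_dirDeriv_snd_smul hf hfc cWt cWtt
    (hasDerivAt_waveSum_snd fun j => hasDerivAt_timeFactorDeriv m (freq n j)) Set.univ
  have x1 := setIntegral_dirDeriv_univ_smul hfx hfxc cW cWx
    (fun x t => hasDerivAt_waveSum_fst x t) (Set.Ioi 0)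
  have x2 := setIntegral_dirDeriv_univ_smul hf hfc cWx cWxx
    (fun x t => hasDerivAt_waveSum_fst x t) (Set.Ioi 0)
  rw [Measure.restrict_univ] at t1 t2
  have itt := (integrable_smul_of_hasCompactSupport hftt.continuous hfttc cW).integrableOn (s := D)
  have ixx := (integrable_smul_of_hasCompactSupport hfxx.continuous hfxxc cW).integrableOn (s := D)
  have iW := ((integrable_smul_of_hasCompactSupport hf.continuous hfc cW).const_mul
    ((m ^ 2 : ℝ) : ℂ)).integrableOn (s := D)
  have iWxx := (integrable_smul_of_hasCompactSupport hf.continuous hfc cWxx).integrableOn (s := D)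
  have e1 : ∀ z, kgFun m f z • wave m n a z =
      dirDeriv (0, 1) (dirDeriv (0, 1) f) z • wave m n a z -
        dirDeriv (1, 0) (dirDeriv (1, 0) f) z • wave m n a z +
        ((m ^ 2 : ℝ) : ℂ) * (f z • wave m n a z) := fun z => by
    simp only [kgFun, Complex.real_smul]
    push_cast
    ring
  have e2 : ∀ z, f z • Wtt z = f z • Wxx z - ((m ^ 2 : ℝ) : ℂ) * (f z • wave m n a z) := fun z => by
    rw [hpde]
    simp only [Complex.real_smul]
    ring
  simp_rw [e1]
  rw [integral_add (f := fun z => dirDeriv (0, 1) (dirDeriv (0, 1) f) z • wave m n a z -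
    dirDeriv (1, 0) (dirDeriv (1, 0) f) z • wave m n a z) (itt.sub ixx) iW, integral_sub itt ixx]
  simp_rw [e2] at t2
  rw [integral_sub iWxx iW] at t2
  rw [t1, t2, x1, x2]
  ring

/-! ### The Klein-Gordon operator on test functions -/

theorem lineDeriv_testFunction_coe (v : ℝ × ℝ) (ψ : 𝓓((⊤ : Opens (ℝ × ℝ)), ℝ)) :
    ((∂_{v} ψ : 𝓓((⊤ : Opens (ℝ × ℝ)), ℝ)) : ℝ × ℝ → ℝ) = dirDeriv v ψ := by
  funext z
  rw [TestFunction.lineDerivOp_eq_lineDerivCLM ℝ, TestFunction.lineDerivCLM_eq_fderivCLM,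
    TestFunction.fderivCLM_apply_of_le _ (by simp)]
  rfl

/-- The Klein-Gordon operator on test functions; it is its own transpose. -/
def kgTest (m : ℝ) (ψ : 𝓓((⊤ : Opens (ℝ × ℝ)), ℝ)) : 𝓓((⊤ : Opens (ℝ × ℝ)), ℝ) :=
  ∂_{((0, 1) : ℝ × ℝ)} (∂_{((0, 1) : ℝ × ℝ)} ψ) - ∂_{((1, 0) : ℝ × ℝ)} (∂_{((1, 0) : ℝ × ℝ)} ψ) +
    (m ^ 2) • ψ

theorem kgTest_apply (m : ℝ) (ψ : 𝓓((⊤ : Opens (ℝ × ℝ)), ℝ)) (z : ℝ × ℝ) :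
    kgTest m ψ z = kgFun m ψ z := by
  rw [kgFun, ← lineDeriv_testFunction_coe, ← lineDeriv_testFunction_coe,
    ← lineDeriv_testFunction_coe, ← lineDeriv_testFunction_coe]
  rfl

theorem timeDeriv_apply (U : Dist) (ψ : 𝓓((⊤ : Opens (ℝ × ℝ)), ℝ)) :
    timeDeriv U ψ = -U (∂_{((0, 1) : ℝ × ℝ)} ψ) := by
  rw [timeDeriv, Distribution.lineDerivOp_apply_apply, map_neg]

theorem spaceDeriv_apply (U : Dist) (ψ : 𝓓((⊤ : Opens (ℝ × ℝ)), ℝ)) :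
    spaceDeriv U ψ = -U (∂_{((1, 0) : ℝ × ℝ)} ψ) := by
  rw [spaceDeriv, Distribution.lineDerivOp_apply_apply, map_neg]

theorem kgOperator_apply (m : ℝ) (U : Dist) (ψ : 𝓓((⊤ : Opens (ℝ × ℝ)), ℝ)) :
    kgOperator m U ψ = U (kgTest m ψ) := by
  have h : kgOperator m U ψ =
      timeDeriv (timeDeriv U) ψ - spaceDeriv (spaceDeriv U) ψ + (m ^ 2) • U ψ := rfl
  rw [h, kgTest, map_add, map_sub, map_smul, timeDeriv_apply, timeDeriv_apply, spaceDeriv_apply,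
    spaceDeriv_apply, neg_neg, neg_neg]

theorem kgOperator_sub (m : ℝ) (U V : Dist) :
    kgOperator m (U - V) = kgOperator m U - kgOperator m V := by
  ext ψ
  have h : (kgOperator m U - kgOperator m V) ψ = kgOperator m U ψ - kgOperator m V ψ := rfl
  rw [h, kgOperator_apply, kgOperator_apply, kgOperator_apply]
  rfl

/-! ### The backward propagator -/

/-- The solution of `(∂²/∂t² - ∂²/∂x² + m²) ψ = f` that vanishes for large times: the convolution
of `f` with the reflected fundamental solution. -/
def backProp (m : ℝ) (f : ℝ × ℝ → ℝ) : ℝ × ℝ → ℝ :=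
  convolution (fun z => fundSol m (-z)) f (ContinuousLinearMap.lsmul ℝ ℝ) volume

theorem backProp_apply (m : ℝ) (f : ℝ × ℝ → ℝ) (z : ℝ × ℝ) :
    backProp m f z = ∫ w, fundSol m (-w) * f (z - w) := rfl

theorem locallyIntegrable_fundSol_neg (m : ℝ) :
    LocallyIntegrable fun z : ℝ × ℝ => fundSol m (-z) := by
  have h : (fun z : ℝ × ℝ => fundSol m (-z)) = Set.indicator {z : ℝ × ℝ | |z.1| ≤ -z.2}
      fun z => 1 / 2 * besselSeries m (z.2 ^ 2 - z.1 ^ 2) := by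
    funext z
    rw [fundSol_eq_indicator]
    by_cases h : |z.1| ≤ -z.2
    · simp [h]
    · simp [h]
  rw [h]
  exact (continuous_besselSeries_interval m).locallyIntegrable.indicator
    (isClosed_le (by fun_prop) (by fun_prop)).measurableSet

theorem integrable_backProp (m : ℝ) {f : ℝ × ℝ → ℝ} (hf : Continuous f) (hc : HasCompactSupport f)
    (z : ℝ × ℝ) : Integrable fun w => fundSol m (-w) * f (z - w) :=
  hc.convolutionExists_right (ContinuousLinearMap.lsmul ℝ ℝ) (locallyIntegrable_fundSol_neg m) hf z

theorem contDiff_backProp (m : ℝ) {f : ℝ × ℝ → ℝ} (hf : ContDiff ℝ (⊤ : ℕ∞) f)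
    (hc : HasCompactSupport f) : ContDiff ℝ (⊤ : ℕ∞) (backProp m f) :=
  hc.contDiff_convolution_right _ (locallyIntegrable_fundSol_neg m) hf

theorem dirDeriv_backProp (m : ℝ) {f : ℝ × ℝ → ℝ} (hf : ContDiff ℝ (⊤ : ℕ∞) f)
    (hc : HasCompactSupport f) (v : ℝ × ℝ) :
    dirDeriv v (backProp m f) = backProp m (dirDeriv v f) := by
  funext z
  have hf1 : ContDiff ℝ 1 f := hf.of_le (by exact_mod_cast le_top)
  rw [dirDeriv, backProp, (hc.hasFDerivAt_convolution_right (ContinuousLinearMap.lsmul ℝ ℝ)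
      (locallyIntegrable_fundSol_neg m) hf1 z).fderiv,
    convolution_precompR_apply _ (locallyIntegrable_fundSol_neg m) (hc.fderiv ℝ)
      (hf1.continuous_fderiv one_ne_zero)]
  rfl

theorem dirDeriv_comp_add_left (f : ℝ × ℝ → ℝ) (v z : ℝ × ℝ) :
    dirDeriv v (fun w => f (z + w)) = fun w => dirDeriv v f (z + w) := by
  funext w
  rw [dirDeriv, fderiv_comp_add_left]
  rfl

/-- The backward propagator inverts the Klein-Gordon operator on functions: move the operator under
the convolution and apply the fundamental solution property to the translate `f (z + ·)`. -/
theorem kgFun_backProp (m : ℝ) {f : ℝ × ℝ → ℝ} (hf : ContDiff ℝ (⊤ : ℕ∞) f)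
    (hc : HasCompactSupport f) (z : ℝ × ℝ) : kgFun m (backProp m f) z = f z := by
  have hd : ∀ v, ContDiff ℝ (⊤ : ℕ∞) (dirDeriv v f) := contDiff_dirDeriv hf
  have hdc : ∀ v, HasCompactSupport (dirDeriv v f) := hasCompactSupport_dirDeriv hc
  have hi : ∀ v, Integrable fun w => fundSol m (-w) * dirDeriv v (dirDeriv v f) (z - w) := fun v =>
    integrable_backProp m (contDiff_dirDeriv (hd v) v).continuous
      (hasCompactSupport_dirDeriv (hdc v) v) z
  have h1 : kgFun m (backProp m f) z = ∫ w, fundSol m (-w) * kgFun m f (z - w) := by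
    rw [kgFun, dirDeriv_backProp m hf hc, dirDeriv_backProp m hf hc,
      dirDeriv_backProp m (hd _) (hdc _), dirDeriv_backProp m (hd _) (hdc _), backProp_apply,
      backProp_apply, backProp_apply, ← integral_sub (hi _) (hi _), ← integral_const_mul,
      ← integral_add (f := fun w => fundSol m (-w) * dirDeriv (0, 1) (dirDeriv (0, 1) f) (z - w) -
        fundSol m (-w) * dirDeriv (1, 0) (dirDeriv (1, 0) f) (z - w)) ((hi _).sub (hi _))
        ((integrable_backProp m hf.continuous hc z).const_mul (m ^ 2))]
    congr 1 with w
    simp only [kgFun]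
    ring
  have h2 : ∀ w, kgFun m f (z + w) = kgFun m (fun w => f (z + w)) w := fun w => by
    simp only [kgFun, dirDeriv_comp_add_left]
  rw [h1, ← integral_neg_eq_self]
  simp only [neg_neg, sub_neg_eq_add, h2]
  rw [integral_fundSol_mul_kgFun m (f := fun w => f (z + w))
    (hf.comp (contDiff_const.add contDiff_id)) (hc.comp_homeomorph (Homeomorph.addLeft z))]
  exact congrArg f (add_zero z)

/-- Finite propagation speed: if `f` is supported in the ball of radius `R`, then `backProp m f` is
supported in the backward light cone with apex `(0, 2R)`. -/
theorem backProp_eq_zero (m : ℝ) {f : ℝ × ℝ → ℝ} {R : ℝ} (hR : ∀ w, R < ‖w‖ → f w = 0)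
    {z : ℝ × ℝ} (hz : 2 * R < |z.1| + z.2) : backProp m f z = 0 := by
  rw [backProp_apply]
  refine integral_eq_zero_of_ae (Filter.Eventually.of_forall fun w => ?_)
  change fundSol m (-w) * f (z - w) = 0
  by_cases hw : -w.2 < |w.1|
  · rw [fundSol_eq_zero m (by simpa using hw), zero_mul]
  · rw [hR, mul_zero]
    by_contra! h
    have h1 : |z.1 - w.1| ≤ R := (norm_fst_le (z - w)).trans h
    have h2 : |z.2 - w.2| ≤ R := (norm_snd_le (z - w)).trans h
    have h3 := abs_sub_abs_le_abs_sub z.1 w.1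
    have h4 := le_abs_self (z.2 - w.2)
    linarith

/-- A smooth cutoff in time, equal to `0` for `t ≤ -1` and to `1` for `t ≥ -1/2`. -/
def timeCutoff (z : ℝ × ℝ) : ℝ := Real.smoothTransition (2 * z.2 + 2)

theorem contDiff_timeCutoff : ContDiff ℝ (⊤ : ℕ∞) timeCutoff :=
  Real.smoothTransition.contDiff.comp (by fun_prop)

theorem timeCutoff_eq_zero {z : ℝ × ℝ} (hz : z.2 ≤ -1) : timeCutoff z = 0 :=
  Real.smoothTransition.zero_of_nonpos (by linarith)

theorem timeCutoff_eq_one {z : ℝ × ℝ} (hz : -(1 / 2) ≤ z.2) : timeCutoff z = 1 :=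
  Real.smoothTransition.one_of_one_le (by linarith)

theorem hasCompactSupport_timeCutoff_mul_backProp (m : ℝ) {f : ℝ × ℝ → ℝ}
    (hc : HasCompactSupport f) : HasCompactSupport fun z => timeCutoff z * backProp m f z := by
  obtain ⟨R, hR0, hR⟩ := hc.isBounded.exists_pos_norm_le
  refine HasCompactSupport.intro (isCompact_closedBall 0 (2 * R + 1)) fun z hz => ?_
  by_cases h1 : z.2 ≤ -1
  · rw [timeCutoff_eq_zero h1, zero_mul]
  · rw [backProp_eq_zero (R := R) m, mul_zero]
    · intro w hw
      exact image_eq_zero_of_notMem_tsupport fun h => hw.not_ge (hR w h)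
    · by_contra! h
      refine hz (mem_closedBall_zero_iff.2 (max_le ?_ (abs_le.2 ⟨?_, ?_⟩)))
      · rw [Real.norm_eq_abs]; linarith
      · linarith
      · linarith [abs_nonneg z.1]

theorem dirDeriv_congr {f g : ℝ × ℝ → ℝ} {s : Set (ℝ × ℝ)} (hs : IsOpen s) (h : Set.EqOn f g s)
    (v : ℝ × ℝ) : Set.EqOn (dirDeriv v f) (dirDeriv v g) s := fun z hz => by
  rw [dirDeriv, dirDeriv, (h.eventuallyEq_of_mem (hs.mem_nhds hz)).fderiv_eq]

theorem kgFun_congr (m : ℝ) {f g : ℝ × ℝ → ℝ} {s : Set (ℝ × ℝ)} (hs : IsOpen s)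
    (h : Set.EqOn f g s) : Set.EqOn (kgFun m f) (kgFun m g) s := fun z hz => by
  rw [kgFun, kgFun, h hz, dirDeriv_congr hs (dirDeriv_congr hs h _) _ hz,
    dirDeriv_congr hs (dirDeriv_congr hs h _) _ hz]

/-! ### Uniqueness -/

/-- Every test function is a value of the Klein-Gordon operator up to a test function supported in
the past: cut the backward propagation of `f` off at negative times, which makes its support
compact. -/
theorem exists_kgTest_sub_tsupport (m : ℝ) (f : 𝓓((⊤ : Opens (ℝ × ℝ)), ℝ)) :
    ∃ ψ : 𝓓((⊤ : Opens (ℝ × ℝ)), ℝ), tsupport (f - kgTest m ψ) ⊆ {z : ℝ × ℝ | z.2 < 0} := by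
  have hψ := contDiff_backProp m f.contDiff f.hasCompactSupport
  let ψ : 𝓓((⊤ : Opens (ℝ × ℝ)), ℝ) := ⟨fun z => timeCutoff z * backProp m f z,
    contDiff_timeCutoff.mul hψ, hasCompactSupport_timeCutoff_mul_backProp m f.hasCompactSupport,
    fun _ _ => trivial⟩
  refine ⟨ψ, ?_⟩
  have hopen : IsOpen {z : ℝ × ℝ | -(1 / 2) < z.2} := isOpen_lt continuous_const continuous_snd
  have hEq : Set.EqOn (ψ : ℝ × ℝ → ℝ) (backProp m f) {z : ℝ × ℝ | -(1 / 2) < z.2} :=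
    fun z hz => by
      change timeCutoff z * backProp m f z = _
      rw [timeCutoff_eq_one (le_of_lt hz), one_mul]
  have hsub : tsupport (f - kgTest m ψ) ⊆ {z : ℝ × ℝ | z.2 ≤ -(1 / 2)} := by
    refine closure_minimal (fun z hz => ?_) (isClosed_le continuous_snd continuous_const)
    by_contra h
    have hz' : -(1 / 2) < z.2 := not_le.1 h
    refine hz ?_
    change f z - kgTest m ψ z = 0
    rw [kgTest_apply, kgFun_congr m hopen hEq hz',
      kgFun_backProp m f.contDiff f.hasCompactSupport, sub_self]
  exact hsub.trans fun z hz => by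
    have : z.2 ≤ -(1 / 2) := hz
    change z.2 < 0
    linarith

/-- A distribution solution of the homogeneous equation that vanishes in the past is zero. -/
theorem eq_zero_of_kgOperator_eq_zero (m : ℝ) {V : Dist}
    (hV : Distribution.IsVanishingOn V {z : ℝ × ℝ | z.2 < 0}) (h : kgOperator m V = 0) :
    V = 0 := by
  ext f
  obtain ⟨ψ, hψ⟩ := exists_kgTest_sub_tsupport m f
  have h1 : V (f - kgTest m ψ) = 0 := hV _ hψ
  rw [map_sub, ← kgOperator_apply, h] at h1
  simpa using h1

/-! ### Existence -/

theorem locallyIntegrable_solution (m : ℝ) (n : ℕ) (a : ℝ) :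
    LocallyIntegrable fun z : ℝ × ℝ => solution m n a z.1 z.2 := by
  simp only [solution_eq]
  exact (continuous_wave m n a).locallyIntegrable.add
    fun z => let ⟨s, hs, hi⟩ := locallyIntegrable_fundSol m z
      ⟨s, hs, hi.ofReal⟩

theorem initialLayer_apply {h : ℝ → ℂ} (hh : Continuous h) (ψ : 𝓓((⊤ : Opens (ℝ × ℝ)), ℝ)) :
    initialLayer h ψ = ∫ x, ψ (x, 0) • h x := by
  have hc : Continuous fun z : ℝ × ℝ => h z.1 := hh.comp continuous_fst
  rw [initialLayer, ofDensity_apply hc.locallyIntegrable]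
  have hi : Integrable (fun z : ℝ × ℝ => (ψ z : ℂ) * h z.1)
      ((volume : Measure ℝ).prod (Measure.dirac (0 : ℝ))) :=
    ((Complex.continuous_ofReal.comp ψ.contDiff.continuous).mul hc).integrable_of_hasCompactSupport
      ((ψ.hasCompactSupport.comp_left (g := fun x : ℝ => (x : ℂ)) rfl).mul_right)
  rw [integral_prod _ hi]
  simp only [integral_dirac, Complex.real_smul]

theorem zeroExtension_solution_apply (m : ℝ) (n : ℕ) (a : ℝ) (ψ : 𝓓((⊤ : Opens (ℝ × ℝ)), ℝ)) :
    zeroExtension (solution m n a) ψ =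
      ∫ z in {z : ℝ × ℝ | 0 < z.2}, (ψ z : ℂ) * solution m n a z.1 z.2 :=
  ofDensity_apply
    (fun z => ((locallyIntegrable_solution m n a) z).mono_measure Measure.restrict_le_self) ψ

theorem isVanishingOn_zeroExtension (m : ℝ) (n : ℕ) (a : ℝ) :
    Distribution.IsVanishingOn (zeroExtension (solution m n a)) {z : ℝ × ℝ | z.2 < 0} := by
  intro ψ hψ
  rw [zeroExtension_solution_apply]
  refine setIntegral_eq_zero_of_forall_eq_zero fun z hz => ?_
  have : ψ z = 0 := image_eq_zero_of_notMem_tsupport fun h => by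
    have h1 : z.2 < 0 := hψ h
    have h2 : 0 < z.2 := hz
    exact lt_asymm h1 h2
  simp [this]

/-- The fundamental solution is supported in `t ≥ 0`, and on the line `t = 0` only at the origin,
a null set. -/
theorem setIntegral_fundSol_mul (m : ℝ) (h : ℝ × ℝ → ℝ) :
    ∫ z in {z : ℝ × ℝ | 0 < z.2}, fundSol m z * h z = ∫ z, fundSol m z * h z := by
  refine setIntegral_eq_integral_of_ae_compl_eq_zero ?_
  filter_upwards [compl_mem_ae_iff.2 (measure_singleton (μ := volume) ((0, 0) : ℝ × ℝ))]
    with z hz h0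
  rw [fundSol_eq_zero, zero_mul]
  by_contra! h1
  have h2 : z.2 ≤ 0 := not_lt.1 h0
  have h3 := abs_nonneg z.1
  exact hz (Prod.ext (abs_eq_zero.1 (by linarith)) (show z.2 = 0 by linarith))

theorem solvesCauchy_zeroExtension (m : ℝ) (n : ℕ) (a : ℝ) :
    SolvesCauchy m diracSource (superosc n a) (deriv (superosc n a))
      (zeroExtension (solution m n a)) := by
  refine ⟨isVanishingOn_zeroExtension m n a, ?_⟩
  ext ψ
  have hψ := ψ.contDiff
  have hc := ψ.hasCompactSupport
  have hF : Continuous (superosc n a) :=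
    continuous_iff_continuousAt.2 fun x => (hasDerivAt_superosc m n a x).continuousAt
  have hF' : deriv (superosc n a) = fun x => waveDeriv m n a (x, 0) :=
    funext (deriv_superosc m n a)
  have hF'c : Continuous (deriv (superosc n a)) := by
    rw [hF']
    exact (continuous_waveDeriv m n a).comp (Continuous.prodMk_left 0)
  have hr : (diracSource + timeDeriv (initialLayer (superosc n a)) +
      initialLayer (deriv (superosc n a))) ψ = diracSource ψ +
      timeDeriv (initialLayer (superosc n a)) ψ + initialLayer (deriv (superosc n a)) ψ := rfl
  have hdirac : diracSource ψ = (ψ (0, 0) : ℂ) := rfl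
  have hkg : ((kgTest m ψ : 𝓓((⊤ : Opens (ℝ × ℝ)), ℝ)) : ℝ × ℝ → ℝ) = kgFun m ψ :=
    funext (kgTest_apply m ψ)
  have hkc : Continuous (kgFun m ψ) := hkg ▸ (kgTest m ψ).contDiff.continuous
  have hks : HasCompactSupport (kgFun m ψ) := hkg ▸ (kgTest m ψ).hasCompactSupport
  have hset : {z : ℝ × ℝ | 0 < z.2} = Set.univ ×ˢ Set.Ioi 0 := by
    ext z; simp
  have i1 := (integrable_smul_of_hasCompactSupport hkc hks (continuous_wave m n a)).integrableOn
    (s := {z : ℝ × ℝ | 0 < z.2})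
  have i2 : Integrable fun z => fundSol m z * kgFun m ψ z := by
    simpa [mul_comm] using (locallyIntegrable_fundSol m).integrable_smul_left_of_hasCompactSupport
      hkc hks
  have i3 : IntegrableOn (fun z => ((fundSol m z * kgFun m ψ z : ℝ) : ℂ)) {z : ℝ × ℝ | 0 < z.2} :=
    i2.ofReal.integrableOn
  have e : ∀ z : ℝ × ℝ, (kgFun m ψ z : ℂ) * solution m n a z.1 z.2 =
      kgFun m ψ z • wave m n a z + ((fundSol m z * kgFun m ψ z : ℝ) : ℂ) := fun z => by
    rw [solution_eq, Complex.real_smul]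
    push_cast
    ring
  rw [kgOperator_apply, zeroExtension_solution_apply, hkg, hr, hdirac, timeDeriv_apply,
    initialLayer_apply hF, initialLayer_apply hF'c, lineDeriv_testFunction_coe]
  simp_rw [e]
  rw [integral_add i1 i3, integral_complex_ofReal, setIntegral_fundSol_mul,
    integral_fundSol_mul_kgFun m hψ hc, hset, setIntegral_kgFun_smul_wave m n a hψ hc, hF']
  simp only [wave_zero]
  ring

theorem hasDerivAt_solution (m : ℝ) (n : ℕ) (a : ℝ) {x : ℝ} (hx : x ≠ 0) :
    HasDerivAt (fun t : ℝ => solution m n a x t) (deriv (superosc n a) x) 0 := by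
  rw [deriv_superosc m]
  refine (hasDerivAt_wave m n a x 0).congr_of_eventuallyEq ?_
  filter_upwards [Iio_mem_nhds (abs_pos.2 hx)] with t ht
  rw [solution_eq, fundSol_eq_zero m (z := (x, t)) ht, Complex.ofReal_zero, add_zero]

end KleinGordon

end

theorem mainTheorem3 (m : ℝ) (hm : 0 ≤ m) (a : ℝ) (ha : 1 < a) (n : ℕ) (hn : 1 ≤ n) :
    LocallyIntegrable (fun z : ℝ × ℝ => KleinGordon.solution m n a z.1 z.2) ∧
    (∀ U : KleinGordon.Dist,
      KleinGordon.SolvesCauchy m KleinGordon.diracSource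
          (KleinGordon.superosc n a) (deriv (KleinGordon.superosc n a)) U ↔
        U = KleinGordon.zeroExtension (KleinGordon.solution m n a)) ∧
    (∀ x : ℝ, x ≠ 0 →
      KleinGordon.solution m n a x 0 = KleinGordon.superosc n a x ∧
      HasDerivAt (fun t : ℝ => KleinGordon.solution m n a x t)
        (deriv (KleinGordon.superosc n a) x) 0) := by
  have hsol := KleinGordon.solvesCauchy_zeroExtension m n a
  refine ⟨KleinGordon.locallyIntegrable_solution m n a, fun U => ⟨fun hU => ?_, fun hU => ?_⟩,
    fun x hx => ⟨?_, KleinGordon.hasDerivAt_solution m n a hx⟩⟩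
  · refine sub_eq_zero.1 (KleinGordon.eq_zero_of_kgOperator_eq_zero m (fun ψ hψ => ?_) ?_)
    · change U ψ - KleinGordon.zeroExtension (KleinGordon.solution m n a) ψ = 0
      rw [hU.1 ψ hψ, hsol.1 ψ hψ, sub_zero]
    · rw [KleinGordon.kgOperator_sub, hU.2, hsol.2, sub_self]
  · rw [hU]
    exact hsol
  · rw [KleinGordon.solution_eq, KleinGordon.wave_zero,
      KleinGordon.fundSol_eq_zero m (by simpa using hx), Complex.ofReal_zero, add_zero]
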